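/- A pseudo MV-algebra is an algebra $(M;\oplus,{}^-,{}^\sim,0,1)$ of type $(2,1,1,0,0)$ such that, with $x\odot y:=(y^-\oplus x^-)^\sim$, for all $x,y,z\in M$: (A1) $x\oplus(y\oplus z)=(x\oplus y)\oplus z$; (A2) $x\oplus 0=0\oplus x=x$; (A3) $x\oplus 1=1\oplus x=1$; (A4) $1^-=1^\sim=0$; (A5) $(x^-\oplus y^-)^\sim=(x^\sim\oplus y^\sim)^-$; (A6) $x\oplus(x^\sim\odot y)=y\oplus(y^\sim\odot x)=(x\odot y^-)\oplus y=(y\odot x^-)\oplus x$; (A7) $x\odot(x^-\oplus y)=(x\oplus y^\sim)\odot y$; (A8) $(x^-)^\sim=x$. It is ordered by $x\le y$ iff $x\vee y=y$, where $x\vee y:=x\oplus(x^\sim\odot y)$. It is representable if it is a subdirect product of linearly ordered pseudo MV-algebras, symmetric if $x^-=x^\sim$ for all $x$, and two-divisible if for every $x\in M$ there is $y\in M$ with $y\le y^-$ and $y\oplus y=x$ (that is, the partial sum $y+y$ exists and equals $x$). A square root on $M$ is a map $r:M\to M$ such that for all $x,y\in M$: $r(x)\odot r(x)=x$; $y\odot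 y\le x$ implies $y\le r(x)$; $r(x^-)=r(x)^-\oplus r(0)$ and $r(x^\sim)=r(0)\oplus r(x)^\sim$. It is strict if $r(0)=r(0)^-$. For a lattice-ordered group $G$ (written additively, not necessarily abelian) with strong unit $u$ (that is, $u\ge 0$ and for each $g\in G$ there is an integer $n\ge 1$ with $g\le nu$), $\Gamma(G,u)$ is the pseudo MV-algebra on $\{x\in G: 0\le x\le u\}$ with $x\oplus y=(x+y)\wedge u$, $x^-=u-x$, $x^\sim=-x+u$, zero $0$ and one $u$. **Theorem.** Let $M$ be a representable pseudo MV-algebra. 1. If $M$ has a strict square root, then $M$ is symmetric and two-divisible, and whenever $M\cong\Gamma(G,u)$ for a lattice-ordered group $G$ with strong unit $u$, there is exactly one $h\in G$ with $h+h=u$ (written $u/2$), and $h$ lies in the center of $G$. 2. In particular, if $M$ is not symmetric, then $M$ admits no strict square root. -/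

import Mathlib

/-- A pseudo MV-algebra `(M; ⊕, ⁻, ∼, 0, 1)`. Here `oplus` is the (not necessarily commutative)
truncated sum, `lneg x` is `x⁻` and `rneg x` is `x∼`. The expression `rneg (oplus (lneg b) (lneg a))`
is the derived product `a ⊙ b`. -/
class PseudoMVAlgebra (M : Type*) where
  oplus : M → M → M
  lneg : M → M
  rneg : M → M
  zero : M
  one : M
  /-- (A1) -/
  oplus_assoc : ∀ x y z, oplus x (oplus y z) = oplus (oplus x y) z
  /-- (A2) -/
  oplus_zero : ∀ x, oplus x zero = x
  zero_oplus : ∀ x, oplus zero x = x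
  /-- (A3) -/
  oplus_one : ∀ x, oplus x one = one
  one_oplus : ∀ x, oplus one x = one
  /-- (A4) -/
  lneg_one : lneg one = zero
  rneg_one : rneg one = zero
  /-- (A5) `(x⁻ ⊕ y⁻)∼ = (x∼ ⊕ y∼)⁻` -/
  neg_oplus_neg : ∀ x y, rneg (oplus (lneg x) (lneg y)) = lneg (oplus (rneg x) (rneg y))
  /-- (A6) `x ⊕ (x∼ ⊙ y) = y ⊕ (y∼ ⊙ x) = (x ⊙ y⁻) ⊕ y = (y ⊙ x⁻) ⊕ x` -/
  sup_eq₁ : ∀ x y, oplus x (rneg (oplus (lneg y) (lneg (rneg x)))) =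
    oplus y (rneg (oplus (lneg x) (lneg (rneg y))))
  sup_eq₂ : ∀ x y, oplus y (rneg (oplus (lneg x) (lneg (rneg y)))) =
    oplus (rneg (oplus (lneg (lneg y)) (lneg x))) y
  sup_eq₃ : ∀ x y, oplus (rneg (oplus (lneg (lneg y)) (lneg x))) y =
    oplus (rneg (oplus (lneg (lneg x)) (lneg y))) x
  /-- (A7) `x ⊙ (x⁻ ⊕ y) = (x ⊕ y∼) ⊙ y` -/
  inf_eq : ∀ x y, rneg (oplus (lneg (oplus (lneg x) y)) (lneg x)) =
    rneg (oplus (lneg y) (lneg (oplus x (rneg y))))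
  /-- (A8) -/
  rneg_lneg : ∀ x, rneg (lneg x) = x

namespace PseudoMVAlgebra

section Basic

variable {M : Type*} [PseudoMVAlgebra M]

/-- The product `x ⊙ y = (y⁻ ⊕ x⁻)∼`. -/
def odot (x y : M) : M := rneg (oplus (lneg y) (lneg x))

/-- The join `x ∨ y = x ⊕ (x∼ ⊙ y)` of the natural lattice structure. -/
def sup (x y : M) : M := oplus x (odot (rneg x) y)

/-- The natural order: `x ≤ y` iff `x ∨ y = y`. -/
def le (x y : M) : Prop := sup x y = y

/-- `x → y = x⁻ ⊕ y`. -/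
def limp (x y : M) : M := oplus (lneg x) y

/-- `x ⇝ y = y ⊕ x∼`. -/
def rimp (x y : M) : M := oplus y (rneg x)

/-- The partial sum `x + y` exists, that is, `x ≤ y⁻`; its value is then `x ⊕ y`. -/
def SumDefined (x y : M) : Prop := le x (lneg y)

/-- Square roots: (Sq1), (Sq2) and the two halves of (Sq3). -/
structure IsSquareRoot (r : M → M) : Prop where
  odot_self : ∀ x, odot (r x) (r x) = x
  le_of_odot_self_le : ∀ x y, le (odot y y) x → le y (r x)
  map_lneg : ∀ x, r (lneg x) = limp (r x) (r zero)
  map_rneg : ∀ x, r (rneg x) = rimp (r x) (r zero)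

/-- A square root `r` is strict if `r(0) = r(0)⁻`. -/
structure IsStrictSquareRoot (r : M → M) : Prop extends IsSquareRoot r where
  strict : r zero = lneg (r zero)

end Basic

/-- `M` is symmetric if `x⁻ = x∼` for all `x`. -/
def IsSymmetric (M : Type*) [PseudoMVAlgebra M] : Prop :=
  ∀ x : M, lneg x = rneg x

/-- `M` is two-divisible if every `x` is of the form `y + y`, with `+` the partial addition. -/
def IsTwoDivisible (M : Type*) [PseudoMVAlgebra M] : Prop :=
  ∀ x : M, ∃ y : M, SumDefined y y ∧ oplus y y = x

/-- `M` is linearly ordered. -/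
def IsLinear (M : Type*) [PseudoMVAlgebra M] : Prop :=
  ∀ x y : M, le x y ∨ le y x

/-- Homomorphisms of pseudo MV-algebras. -/
structure IsHom {M N : Type*} [PseudoMVAlgebra M] [PseudoMVAlgebra N] (f : M → N) : Prop where
  map_oplus : ∀ x y, f (oplus x y) = oplus (f x) (f y)
  map_lneg : ∀ x, f (lneg x) = lneg (f x)
  map_rneg : ∀ x, f (rneg x) = rneg (f x)
  map_zero : f zero = zero
  map_one : f one = one

/-- `M` is representable if it is a subdirect product of linearly ordered pseudo MV-algebras `N i`:
the homomorphisms `π i : M → N i` are surjective and jointly injective. Each `N i` is a quotient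
of `M` and distinct congruences suffice as indices, so one universe is enough. -/
def IsRepresentable.{v} (M : Type v) [PseudoMVAlgebra M] : Prop :=
  ∃ (ι : Type v) (N : ι → Type v) (_ : ∀ i, PseudoMVAlgebra (N i)) (π : ∀ i, M → N i),
    (∀ i, IsLinear (N i)) ∧ (∀ i, IsHom (π i)) ∧ (∀ i, Function.Surjective (π i)) ∧
      ∀ x y : M, (∀ i, π i x = π i y) → x = y

end PseudoMVAlgebra

/-- `u` is a strong unit of the lattice-ordered group `G` (written additively, not necessarily
commutative). -/
class IsStrongUnit {G : Type*} [Lattice G] [AddGroup G] (u : G) : Prop where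
  nonneg : 0 ≤ u
  exists_le_nsmul : ∀ g : G, ∃ n : ℕ, 1 ≤ n ∧ g ≤ n • u

/-- The underlying set `[0, u]` of `Γ(G, u)`. -/
@[ext]
structure Gamma (G : Type*) [Lattice G] [AddGroup G] (u : G) where
  val : G
  nonneg : 0 ≤ val
  le_unit : val ≤ u

namespace Gamma

section Construction

variable {G : Type*} [Lattice G] [AddGroup G] [AddLeftMono G] [AddRightMono G] {u : G}

/-- `x ⊕ y = (x + y) ∧ u`. -/
def add [IsStrongUnit u] (x y : Gamma G u) : Gamma G u :=
  ⟨(x.val + y.val) ⊓ u, le_inf (add_nonneg x.nonneg y.nonneg) (IsStrongUnit.nonneg), inf_le_right⟩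

/-- `x⁻ = u - x`. -/
def negL (x : Gamma G u) : Gamma G u :=
  ⟨u - x.val, sub_nonneg.2 x.le_unit, sub_le_self u x.nonneg⟩

/-- `x∼ = -x + u`. -/
def negR (x : Gamma G u) : Gamma G u :=
  ⟨-x.val + u, by simpa using add_le_add_right x.le_unit (-x.val), by
    simpa using add_le_add_left (neg_nonpos.2 x.nonneg) u⟩

theorem add_val [IsStrongUnit u] (x y : Gamma G u) :
    (add x y).val = (x.val + y.val) ⊓ u := rfl

theorem prod_val [IsStrongUnit u] (x y : Gamma G u) :
    (negR (add (negL y) (negL x))).val = (x.val - u + y.val) ⊔ 0 := by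
  simp only [negR, add, negL, neg_inf, sup_add, sub_eq_add_neg, neg_add_rev, neg_neg, add_assoc,
    neg_add_cancel, add_zero]

theorem prod_val' [IsStrongUnit u] (x y : Gamma G u) :
    (negL (add (negR y) (negR x))).val = (x.val - u + y.val) ⊔ 0 := by
  simp only [negR, add, negL, neg_inf, add_sup, sub_eq_add_neg, neg_add_rev, neg_neg, ← add_assoc,
    add_neg_cancel, zero_add]

theorem sup_val [IsStrongUnit u] (x y : Gamma G u) :
    (add x (negR (add (negL y) (negL (negR x))))).val = x.val ⊔ y.val := by
  have h : x.val + ((negR x).val - u + y.val) = y.val := by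
    simp [negR, sub_eq_add_neg, add_assoc]
  rw [add_val, prod_val, add_sup, h, add_zero, sup_comm]
  exact inf_eq_left.2 (sup_le x.le_unit y.le_unit)

theorem sup_val' [IsStrongUnit u] (x y : Gamma G u) :
    (add (negR (add (negL (negL y)) (negL x))) y).val = x.val ⊔ y.val := by
  have h : x.val - u + (negL y).val + y.val = x.val := by
    simp [negL, sub_eq_add_neg, add_assoc]
  rw [add_val, prod_val, sup_add, h, zero_add]
  exact inf_eq_left.2 (sup_le x.le_unit y.le_unit)

/-- The pseudo MV-algebra `Γ(G, u) = ([0, u]; ⊕, ⁻, ∼, 0, u)`. -/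
instance instPseudoMVAlgebra [IsStrongUnit u] : PseudoMVAlgebra (Gamma G u) where
  oplus := add
  lneg := negL
  rneg := negR
  zero := ⟨0, le_rfl, IsStrongUnit.nonneg⟩
  one := ⟨u, IsStrongUnit.nonneg, le_rfl⟩
  oplus_assoc x y z := by
    have hu : (0 : G) ≤ u := IsStrongUnit.nonneg
    have h1 : u ≤ x.val + u := le_add_of_nonneg_left x.nonneg
    have h2 : u ≤ u + z.val := le_add_of_nonneg_right z.nonneg
    ext
    simp only [add, add_inf, inf_add, inf_assoc, inf_eq_right.2 h1, inf_eq_right.2 h2, add_assoc]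
  oplus_zero x := by ext; simp [add, x.le_unit]
  zero_oplus x := by ext; simp [add, x.le_unit]
  oplus_one x := by ext; simp [add, x.nonneg]
  one_oplus x := by ext; simp [add, x.nonneg]
  lneg_one := by ext; simp [negL]
  rneg_one := by ext; simp [negR]
  neg_oplus_neg x y := by ext; rw [prod_val, prod_val']
  sup_eq₁ x y := by ext; rw [sup_val, sup_val, sup_comm]
  sup_eq₂ x y := by ext; rw [sup_val, sup_val', sup_comm]
  sup_eq₃ x y := by ext; rw [sup_val', sup_val', sup_comm]
  inf_eq x y := by
    ext
    rw [prod_val, prod_val]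
    simp only [add, negL, negR, add_inf, inf_add, sub_eq_add_neg, add_assoc]
    simp [← add_assoc, inf_comm]
  rneg_lneg x := by ext; simp [negL, negR]

/-- The derived product of `Γ(G, u)` is `x ⊙ y = (x - u + y) ∨ 0`. -/
theorem odot_val [IsStrongUnit u] (x y : Gamma G u) :
    (PseudoMVAlgebra.odot x y).val = (x.val - u + y.val) ⊔ 0 := prod_val x y

/-- The natural order of `Γ(G, u)` is the order of `G`. -/
theorem le_iff [IsStrongUnit u] (x y : Gamma G u) :
    PseudoMVAlgebra.le x y ↔ x.val ≤ y.val := by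
  rw [← sup_eq_right, ← sup_val x y, ← Gamma.ext_iff]
  rfl

end Construction

end Gamma

/-! Put c = r(0), so c⁻ = c = c∼. The element w = r(x) ⊙ c is a half of x lying below c and
commuting with c (`exists_half`), which gives two-divisibility. Halving twice writes x through some
z with z ⊕ z ≤ c; for such z the complements c - z and -z + c coincide, whence z⁻ = z∼
(`IsCommutingHalf.lneg_eq_rneg`), and symmetry passes to sums. In Γ(G, u) the image h of c satisfies
h + h = u and commutes with a half of every element of [0, u], hence with [0, u], which generates G;
so h is central. Any other half of u commutes with h, and torsion-freeness makes it equal to h. -/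

namespace PseudoMVAlgebra

/-! ### Order, residuation and cancellation of untruncated sums. -/

section Order

variable {M : Type*} [PseudoMVAlgebra M]

theorem lneg_rneg (x : M) : lneg (rneg x) = x := by
  have h := neg_oplus_neg x (one : M)
  rw [lneg_one, oplus_zero, rneg_one, oplus_zero, rneg_lneg] at h
  exact h.symm

theorem lneg_zero : lneg (zero : M) = one := by rw [← rneg_one, lneg_rneg]

theorem odot_eq_lneg (a b : M) : odot a b = lneg (oplus (rneg b) (rneg a)) :=
  neg_oplus_neg b a

theorem lneg_odot (a b : M) : lneg (odot a b) = oplus (lneg b) (lneg a) := lneg_rneg _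

theorem rneg_odot (a b : M) : rneg (odot a b) = oplus (rneg b) (rneg a) := by
  rw [odot_eq_lneg, rneg_lneg]

theorem lneg_oplus (a b : M) : lneg (oplus a b) = odot (lneg b) (lneg a) := by
  rw [odot_eq_lneg, rneg_lneg, rneg_lneg]

theorem rneg_oplus (a b : M) : rneg (oplus a b) = odot (rneg b) (rneg a) := by
  rw [odot, lneg_rneg, lneg_rneg]

theorem odot_one (a : M) : odot a one = a := by
  rw [odot, lneg_one, zero_oplus, rneg_lneg]

theorem one_odot (a : M) : odot one a = a := by
  rw [odot, lneg_one, oplus_zero, rneg_lneg]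

theorem oplus_rneg (x : M) : oplus x (rneg x) = one := by
  have h := sup_eq₁ x (one : M)
  rwa [lneg_one, zero_oplus, lneg_rneg, one_oplus] at h

theorem lneg_oplus_self (x : M) : oplus (lneg x) x = one := by
  simpa only [rneg_lneg] using oplus_rneg (lneg x)

theorem sup_comm (x y : M) : sup x y = sup y x := sup_eq₁ x y

theorem sup_eq_odot_lneg_oplus (x y : M) : sup x y = oplus (odot x (lneg y)) y :=
  (sup_eq₁ x y).trans (sup_eq₂ x y)

theorem le_iff_lneg_oplus {x y : M} : le x y ↔ oplus (lneg x) y = one := by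
  constructor
  · intro h
    rw [le, sup] at h
    rw [← h, oplus_assoc, lneg_oplus_self, one_oplus]
  · intro h
    rw [le, sup_comm, sup, odot, lneg_rneg, h, rneg_one, oplus_zero]

theorem le_iff_oplus_rneg {x y : M} : le x y ↔ oplus y (rneg x) = one := by
  constructor
  · intro h
    rw [le, sup_comm, sup_eq_odot_lneg_oplus] at h
    rw [← h, ← oplus_assoc, oplus_rneg, oplus_one]
  · intro h
    rw [le, sup_eq_odot_lneg_oplus, odot_eq_lneg, rneg_lneg, h, lneg_one, zero_oplus]

theorem le_oplus_left (d x : M) : le x (oplus d x) := by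
  rw [le_iff_oplus_rneg, ← oplus_assoc, oplus_rneg, oplus_one]

theorem le_oplus_right (x d : M) : le x (oplus x d) := by
  rw [le_iff_lneg_oplus, oplus_assoc, lneg_oplus_self, one_oplus]

theorem zero_le (x : M) : le zero x := by
  rw [le_iff_lneg_oplus, lneg_zero, one_oplus]

theorem le_trans {x y z : M} (hxy : le x y) (hyz : le y z) : le x z := by
  rw [le, sup] at hxy hyz
  rw [← hyz, ← hxy, ← oplus_assoc]
  exact le_oplus_right _ _

theorem le_antisymm {x y : M} (hxy : le x y) (hyx : le y x) : x = y := by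
  rw [le] at hxy hyx
  rw [← hxy, sup_comm, hyx]

theorem oplus_le_oplus_left {x y : M} (h : le x y) (z : M) : le (oplus z x) (oplus z y) := by
  rw [le, sup] at h
  rw [← h, oplus_assoc]
  exact le_oplus_right _ _

theorem lneg_le_lneg {x y : M} (h : le x y) : le (lneg y) (lneg x) := by
  rw [le_iff_oplus_rneg, rneg_lneg]
  exact le_iff_lneg_oplus.1 h

theorem rneg_le_rneg {x y : M} (h : le x y) : le (rneg y) (rneg x) := by
  rw [le_iff_lneg_oplus, lneg_rneg]
  exact le_iff_oplus_rneg.1 h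

theorem odot_le_left (a b : M) : le (odot a b) a := by
  rw [le_iff_lneg_oplus, lneg_odot, ← oplus_assoc, lneg_oplus_self, oplus_one]

theorem odot_le_right (a b : M) : le (odot a b) b := by
  rw [le_iff_oplus_rneg, rneg_odot, oplus_assoc, oplus_rneg, one_oplus]

theorem odot_le_odot_right {x y : M} (h : le x y) (z : M) : le (odot x z) (odot y z) :=
  rneg_le_rneg (oplus_le_oplus_left (lneg_le_lneg h) _)

theorem odot_lneg_oplus (x y : M) :
    odot x (oplus (lneg x) y) = odot (oplus x (rneg y)) y := inf_eq x y

theorem odot_lneg_oplus_of_le {x y : M} (h : le y x) : odot x (oplus (lneg x) y) = y := by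
  rw [odot_lneg_oplus, le_iff_oplus_rneg.1 h, one_odot]

theorem oplus_rneg_odot_of_le {x y : M} (h : le x y) : odot (oplus x (rneg y)) y = x := by
  rw [← odot_lneg_oplus, le_iff_lneg_oplus.1 h, odot_one]

theorem oplus_odot_lneg_of_le {x y : M} (h : le x (lneg y)) : odot (oplus x y) (lneg y) = x := by
  simpa only [rneg_lneg] using oplus_rneg_odot_of_le h

/-- The bounds say that the sums are not truncated, so b is recovered as a∼ ⊙ (a ⊕ b). -/
theorem oplus_left_cancel {a b d : M} (hb : le b (rneg a)) (hd : le d (rneg a))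
    (h : oplus a b = oplus a d) : b = d := by
  have h₁ := odot_lneg_oplus_of_le hb
  have h₂ := odot_lneg_oplus_of_le hd
  rw [lneg_rneg] at h₁ h₂
  rw [← h₁, h, h₂]

theorem oplus_right_cancel {a b d : M} (hb : le b (lneg a)) (hd : le d (lneg a))
    (h : oplus b a = oplus d a) : b = d := by
  rw [← oplus_odot_lneg_of_le hb, h, oplus_odot_lneg_of_le hd]

end Order

/-! ### Elements that are their own negation. -/

section SelfNegation

variable {M : Type*} [PseudoMVAlgebra M] {c : M}

theorem rneg_eq_of_lneg_eq (hc : lneg c = c) : rneg c = c := by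
  conv_lhs => rw [← hc, rneg_lneg]

/-- In group terms, with c + c = u: (y - c) + (-c + y) = y - u + y. -/
theorem odot_oplus_odot_of_le (hc : lneg c = c) {y : M} (hy : le c y) :
    oplus (odot y c) (odot c y) = odot y y := by
  have hc' := rneg_eq_of_lneg_eq hc
  have hwc : oplus (odot y c) c = y := by
    have h := hy
    rwa [le, sup_comm, sup_eq_odot_lneg_oplus, hc] at h
  have hyc : le (rneg y) c := by simpa only [hc'] using rneg_le_rneg hy
  have h₁ : oplus (odot c y) (rneg y) = c := by
    have h := hyc
    rwa [le, sup_comm, sup_eq_odot_lneg_oplus, lneg_rneg] at h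
  have h₂ : le (oplus (odot y c) (odot c y)) y := by
    conv_rhs => rw [← hwc]
    exact oplus_le_oplus_left (odot_le_left c y) _
  rw [← oplus_rneg_odot_of_le h₂, ← oplus_assoc, h₁, hwc]

/-- `w` is a half of `w ⊕ w` below `c`, commuting with `c`. -/
structure IsCommutingHalf (c w : M) : Prop where
  le : le w c
  comm : oplus w c = oplus c w

theorem IsCommutingHalf.le_lneg {w : M} (h : IsCommutingHalf c w) (hc : lneg c = c) :
    PseudoMVAlgebra.le c (lneg w) := by
  simpa only [hc] using lneg_le_lneg h.le

theorem IsCommutingHalf.le_rneg {w : M} (h : IsCommutingHalf c w) (hc : lneg c = c) :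
    PseudoMVAlgebra.le c (rneg w) := by
  simpa only [rneg_eq_of_lneg_eq hc] using rneg_le_rneg h.le

/-- With a = c - z and b = -z + c, one has z⁻ = c + a and z∼ = b + c = c + b, so it suffices that a
= b. -/
theorem IsCommutingHalf.lneg_eq_rneg {z : M} (h : IsCommutingHalf c z) (hc : lneg c = c)
    (hz : PseudoMVAlgebra.le (oplus z z) c) : lneg z = rneg z := by
  have hc' := rneg_eq_of_lneg_eq hc
  have hcl := h.le_lneg hc
  have hcr := h.le_rneg hc
  set a := odot c (lneg z) with ha
  set b := odot (rneg z) c with hb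
  have hac : PseudoMVAlgebra.le a c := odot_le_left _ _
  have hbc : PseudoMVAlgebra.le b c := odot_le_right _ _
  have haz : oplus a z = c := by
    have h' := h.le
    rwa [PseudoMVAlgebra.le, sup_comm, sup_eq_odot_lneg_oplus] at h'
  have hzb : oplus z b = c := h.le
  have hca : oplus c a = lneg z := by
    have h' := hcl
    rwa [PseudoMVAlgebra.le, sup, hc'] at h'
  have hbc' : oplus b c = rneg z := by
    have h' := hcr
    rwa [PseudoMVAlgebra.le, sup_comm, sup_eq_odot_lneg_oplus, hc] at h'
  have hcb : oplus c b = rneg z := by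
    have h₁ : b = odot c (rneg z) := by
      rw [hb]
      conv_lhs => rw [← hc']
      conv_rhs => rw [← hc']
      rw [← rneg_oplus, ← rneg_oplus, h.comm]
    have h₂ := hcr
    rw [PseudoMVAlgebra.le, sup, hc'] at h₂
    rw [h₁, h₂]
  -- Here z ⊕ z ≤ c enters: it keeps z ⊕ a below z⁻, so that z can be cancelled on the right.
  have hza : PseudoMVAlgebra.le z a := by
    have h₁ : PseudoMVAlgebra.le (oplus z z) (oplus a z) := by rwa [haz]
    have h₂ := odot_le_odot_right h₁ (lneg z)
    rwa [oplus_odot_lneg_of_le (le_trans h.le hcl),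
      oplus_odot_lneg_of_le (le_trans hac hcl)] at h₂
  have hzal : PseudoMVAlgebra.le (oplus z a) (lneg z) := by
    refine le_trans (oplus_le_oplus_left hac z) ?_
    rw [h.comm, ← hca]
    exact oplus_le_oplus_left hza c
  -- Cancel z in (z + a) + z = z + c = c + z.
  have hzac : oplus z a = c := by
    refine oplus_right_cancel hzal hcl ?_
    rw [← oplus_assoc, haz, h.comm]
  have hab : a = b :=
    oplus_left_cancel (le_trans hac hcr) (le_trans hbc hcr) (hzac.trans hzb.symm)
  rw [← hca, hab, hcb]

end SelfNegation

/-! ### Halves produced by a strict square root. -/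

namespace IsStrictSquareRoot

variable {M : Type*} [PseudoMVAlgebra M] {r : M → M}

theorem lneg_zero (hr : IsStrictSquareRoot r) : lneg (r zero) = r zero := hr.strict.symm

theorem zero_le (hr : IsStrictSquareRoot r) (x : M) : le (r zero) (r x) := by
  apply hr.le_of_odot_self_le
  rw [hr.odot_self]
  exact PseudoMVAlgebra.zero_le x

theorem odot_zero_oplus_self (hr : IsStrictSquareRoot r) (x : M) :
    oplus (odot (r x) (r zero)) (odot (r x) (r zero)) = x := by
  -- The square root of x∼ is c ⊕ r(x)∼, whose left negation is r(x) ⊙ c.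
  have h := congrArg lneg (hr.odot_self (rneg x))
  rw [hr.map_rneg, rimp, lneg_odot, lneg_oplus, lneg_rneg, lneg_rneg, hr.lneg_zero] at h
  exact h

theorem odot_zero_comm (hr : IsStrictSquareRoot r) (x : M) :
    odot (r x) (r zero) = odot (r zero) (r x) := by
  have hc := hr.lneg_zero
  have hle : le (r zero) (rneg (odot (r x) (r zero))) := by
    simpa only [rneg_eq_of_lneg_eq hc] using rneg_le_rneg (odot_le_right (r x) (r zero))
  -- Adding either product to r(x) ⊙ c on the right yields x.
  refine oplus_left_cancel (le_trans (odot_le_right _ _) hle)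
    (le_trans (odot_le_left _ _) hle) ?_
  rw [hr.odot_zero_oplus_self, odot_oplus_odot_of_le hc (hr.zero_le x), hr.odot_self]

theorem exists_half (hr : IsStrictSquareRoot r) (x : M) :
    ∃ w, IsCommutingHalf (r zero) w ∧ oplus w w = x := by
  refine ⟨odot (r x) (r zero), ⟨odot_le_right _ _, ?_⟩, hr.odot_zero_oplus_self x⟩
  have hc := hr.lneg_zero
  have h₁ := hr.zero_le x
  have h₂ := hr.zero_le x
  rw [le, sup_comm, sup_eq_odot_lneg_oplus, hc] at h₁
  rw [le, sup, rneg_eq_of_lneg_eq hc, ← hr.odot_zero_comm] at h₂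
  rw [h₁, h₂]

theorem isSymmetric (hr : IsStrictSquareRoot r) : IsSymmetric M := by
  intro x
  obtain ⟨w, hw, rfl⟩ := hr.exists_half x
  -- The second halving ensures z ⊕ z = w ≤ c.
  obtain ⟨z, hz, rfl⟩ := hr.exists_half w
  have h := hz.lneg_eq_rneg hr.lneg_zero hw.le
  simp only [lneg_oplus, rneg_oplus, h]

theorem isTwoDivisible (hr : IsStrictSquareRoot r) : IsTwoDivisible M := by
  intro x
  obtain ⟨w, hw, hx⟩ := hr.exists_half x
  exact ⟨w, le_trans hw.le (hw.le_lneg hr.lneg_zero), hx⟩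

end IsStrictSquareRoot

theorem IsHom.map_le {M N : Type*} [PseudoMVAlgebra M] [PseudoMVAlgebra N] {f : M → N}
    (hf : IsHom f) {x y : M} (h : le x y) : le (f x) (f y) := by
  rw [le_iff_lneg_oplus] at h ⊢
  rw [← hf.map_lneg, ← hf.map_oplus, h, hf.map_one]

end PseudoMVAlgebra

/-! ### Lattice-ordered groups and the half of the unit. -/

section LatticeOrderedGroup

variable {G : Type*} [Lattice G] [AddGroup G] [AddLeftMono G] [AddRightMono G]

theorem AddCommute.eq_of_add_self_eq {g h : G} (hgh : AddCommute g h) (H : g + g = h + h) :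
    g = h := by
  have key : ∀ {a b : G}, AddCommute a b → a + a = b + b → a ≤ b := by
    intro a b hab e
    rw [← sub_nonneg]
    apply nsmul_two_semiclosed
    rw [two_nsmul]
    -- Commutation turns 2(b - a) into 2b - 2a = 0.
    have hc : AddCommute b (-a) := (hab.symm).neg_right
    rw [sub_eq_add_neg, hc.symm.add_add_add_comm, ← e, ← neg_add_rev, add_neg_cancel]
  exact _root_.le_antisymm (key hgh H) (key hgh.symm H.symm)

/-- A lattice-ordered group is generated by the interval `[0, u]` of a strong unit `u`. -/
theorem AddSubgroup.eq_top_of_forall_mem_unit_interval {u : G} [IsStrongUnit u]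
    (S : AddSubgroup G) (hS : ∀ g : G, 0 ≤ g → g ≤ u → g ∈ S) : S = ⊤ := by
  have hpos : ∀ n : ℕ, ∀ g : G, 0 ≤ g → g ≤ n • u → g ∈ S := by
    intro n
    induction n with
    | zero =>
      intro g h₀ h₁
      rw [zero_nsmul] at h₁
      rw [_root_.le_antisymm h₁ h₀]
      exact S.zero_mem
    | succ n ih =>
      intro g h₀ h₁
      -- Peel off g ∧ u; the remainder (-u + g) ∨ 0 lies in [0, n • u].
      have h₂ : g ⊓ u ∈ S := hS _ (le_inf h₀ IsStrongUnit.nonneg) inf_le_right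
      have h₃ : -(g ⊓ u) + g ∈ S := by
        apply ih
        · exact le_neg_add_iff_add_le.2 (by simp)
        · rw [neg_inf, sup_add, neg_add_cancel]
          refine sup_le (nsmul_nonneg IsStrongUnit.nonneg n) ?_
          rw [neg_add_le_iff_le_add, ← succ_nsmul']
          exact h₁
      simpa using S.add_mem h₂ h₃
  have hpos' : ∀ g : G, 0 ≤ g → g ∈ S := fun g hg => by
    obtain ⟨n, -, hn⟩ := IsStrongUnit.exists_le_nsmul (u := u) g
    exact hpos n g hg hn
  rw [eq_top_iff]
  intro g _
  have h₁ : 0 ≤ g - g ⊓ 0 := sub_nonneg.2 inf_le_left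
  have h₂ : 0 ≤ -(g ⊓ 0) := neg_nonneg.2 inf_le_right
  have h₃ : g ⊓ 0 ∈ S := by simpa using S.neg_mem (hpos' _ h₂)
  simpa using S.add_mem (hpos' _ h₁) h₃

open PseudoMVAlgebra in
theorem PseudoMVAlgebra.IsStrictSquareRoot.exists_unique_half_unit {M : Type*}
    [PseudoMVAlgebra M] {r : M → M} (hr : IsStrictSquareRoot r) {u : G} [IsStrongUnit u]
    (e : M ≃ Gamma G u) (he : IsHom e) :
    ∃ h : G, h + h = u ∧ (∀ g : G, g + g = u → g = h) ∧ h ∈ AddSubgroup.center G := by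
  set h : G := (e (r zero)).val with hh
  have hu : h + h = u := by
    have h₁ : u - h = h := by
      have h₂ := congrArg Gamma.val (he.map_lneg (r zero))
      rw [hr.lneg_zero] at h₂
      exact h₂.symm
    rw [sub_eq_iff_eq_add] at h₁
    exact h₁.symm
  have hS : AddSubgroup.centralizer {h} = ⊤ := by
    refine AddSubgroup.eq_top_of_forall_mem_unit_interval (u := u) _ fun g h₀ h₁ => ?_
    obtain ⟨w, hw, hx⟩ := hr.exists_half (e.symm ⟨g, h₀, h₁⟩)
    have hwh : (e w).val ≤ h := (Gamma.le_iff _ _).1 (he.map_le hw.le)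
    have hc : (e w).val + h = h + (e w).val := by
      have h₂ := congrArg (fun x => (e x).val) hw.comm
      simp only [he.map_oplus] at h₂
      change ((e w).val + h) ⊓ u = (h + (e w).val) ⊓ u at h₂
      -- Both sums are at most h + h = u, so truncation does nothing.
      rwa [inf_eq_left.2 ((add_le_add_left hwh h).trans_eq hu),
        inf_eq_left.2 ((add_le_add_right hwh h).trans_eq hu)] at h₂
    have hg : (e w).val + (e w).val = g := by
      have h₂ := congrArg (fun x => (e x).val) hx
      simp only [he.map_oplus, Equiv.apply_symm_apply] at h₂
      change ((e w).val + (e w).val) ⊓ u = g at h₂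
      rwa [inf_eq_left.2 ((add_le_add hwh hwh).trans_eq hu)] at h₂
    rw [AddSubgroup.mem_centralizer_singleton_iff, ← hg]
    have hc' : AddCommute (e w).val h := hc
    exact hc'.add_left hc'
  have hcomm : ∀ g : G, AddCommute g h := fun g => by
    have : g ∈ AddSubgroup.centralizer {h} := hS ▸ AddSubgroup.mem_top g
    exact AddSubgroup.mem_centralizer_singleton_iff.1 this
  exact ⟨h, hu, fun g hg => (hcomm g).eq_of_add_self_eq (hg.trans hu.symm),
    AddSubgroup.mem_center_iff.2 hcomm⟩

end LatticeOrderedGroup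

theorem mainTheorem9 {M : Type*} [PseudoMVAlgebra M]
    (hM : PseudoMVAlgebra.IsRepresentable M) :
    (∀ r : M → M, PseudoMVAlgebra.IsStrictSquareRoot r →
      PseudoMVAlgebra.IsSymmetric M ∧ PseudoMVAlgebra.IsTwoDivisible M ∧
      ∀ (G : Type*) [Lattice G] [AddGroup G] [AddLeftMono G] [AddRightMono G]
        (u : G) [IsStrongUnit u] (e : M ≃ Gamma G u), PseudoMVAlgebra.IsHom e →
        ∃ h : G, h + h = u ∧ (∀ g : G, g + g = u → g = h) ∧ h ∈ AddSubgroup.center G) ∧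
    (¬ PseudoMVAlgebra.IsSymmetric M →
      ¬ ∃ r : M → M, PseudoMVAlgebra.IsStrictSquareRoot r) := by
  refine ⟨fun r hr => ⟨hr.isSymmetric, hr.isTwoDivisible, ?_⟩, fun hM' ⟨r, hr⟩ =>
    hM' hr.isSymmetric⟩
  intro G _ _ _ _ u _ e he
  exact hr.exists_unique_half_unit e he
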